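/- Let $\Phi_a\subset\mathbb{R}^2$ be a homogeneous Poisson point process of density $\lambda_a>0$ (the access points, APs), let $o$ denote the origin and $\lambda_u>0$ the density of the user equipments (UEs). Let $\mathcal{V}^*$ denote the Voronoi cell, in the tessellation generated by $\Phi_a$, of the point of $\Phi_a$ that is closest to $o$, that is, the set of points strictly closer to this point than to any other point of $\Phi_a$. For $x,x^*\in\mathbb{R}^2$ let $p_c(x\mid x^*)$ be the probability that $x\in\mathcal{V}^*$ conditioned on the closest point of $\Phi_a$ to $o$ being $x^*$, understood as the limit, as $\varepsilon\downarrow0$, of the probability conditioned on this closest point lying in the open disc of radius $\varepsilon$ centred at $x^*$ (for $x^*=o$ this conditions on an AP being at the origin). For a receiver position $x_R\in\mathbb{R}^2$ and $r\ge0$, the equivalent UE density is \[ \lambda_{x_R,u}(r)=\lambda_u\left(1-\frac{1}{2\pi}\int_0^{2\pi}p_c\big((r\cos\theta,r\sin\theta)+x_R\mid x^*\big)\,d\theta\right). \] Then, for every $x^*\in\mathbb{R}^2$, the limits and the integrals defining the density for $x_R=x^*$ exist, and for $x_R=x^*$ and all $r\ge0$, \[ \lambda_{x^*,u}(r)\le\lambda_u\left(1-e^{-\lambda_a\pi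 r^2}\right). \] For every $r>0$, equality holds if and only if $x^*=o$; for $r=0$ both sides are equal to $0$ for every $x^*$. -/

import Mathlib

open MeasureTheory Filter Topology

noncomputable section

/-- The Euclidean plane; its origin `o` is `0`. -/
abbrev Plane : Type := EuclideanSpace ℝ (Fin 2)

/-- The point with polar coordinates `(r, θ)`. -/
def polarPoint (r θ : ℝ) : Plane := !₂[r * Real.cos θ, r * Real.sin θ]

/-- `Φ`, a random locally finite set of points of the plane, is a homogeneous Poisson point process
of density `lam` under `P`: the number of points in a bounded Borel set `B` is a Poisson random
variable of mean `lam * |B|`, and the numbers of points in finitely many pairwise disjoint bounded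
Borel sets are independent. -/
structure IsHPPP {Ω : Type*} [MeasurableSpace Ω] (P : Measure Ω) (Φ : Ω → Set Plane)
    (lam : ℝ) : Prop where
  finite_inter : ∀ (ω : Ω) (B : Set Plane), Bornology.IsBounded B → (Φ ω ∩ B).Finite
  measurable_count : ∀ B : Set Plane, MeasurableSet B → Bornology.IsBounded B →
    Measurable fun ω => (Φ ω ∩ B).ncard
  count_law : ∀ B : Set Plane, MeasurableSet B → Bornology.IsBounded B →
    P.map (fun ω => (Φ ω ∩ B).ncard) =
      ProbabilityTheory.poissonMeasure (lam * volume.real B).toNNReal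
  count_indep : ∀ (n : ℕ) (B : Fin n → Set Plane), (∀ i, MeasurableSet (B i)) →
    (∀ i, Bornology.IsBounded (B i)) → Pairwise (fun i j => Disjoint (B i) (B j)) →
    ProbabilityTheory.iIndepFun (fun i ω => (Φ ω ∩ B i).ncard) P

/-- `a` is the (unique) closest point of the configuration `S` to the origin. -/
def IsNearest (S : Set Plane) (a : Plane) : Prop :=
  a ∈ S ∧ ∀ z ∈ S, z ≠ a → ‖a‖ < ‖z‖

/-- The Voronoi cell, in the tessellation generated by `S`, of the point `a` of `S`. -/
def voronoiCell (S : Set Plane) (a : Plane) : Set Plane :=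
  {y | ∀ z ∈ S \ {a}, ‖y - a‖ < ‖y - z‖}

/-- The event that the closest point of `Φ` to the origin, `x^*`, lies in `B`. -/
def nearestIn {Ω : Type*} (Φ : Ω → Set Plane) (B : Set Plane) : Set Ω :=
  {ω | ∃ a ∈ B, IsNearest (Φ ω) a}

/-- The event that `x` lies in the Voronoi cell of the closest point of `Φ` to the origin. -/
def inGuardRegion {Ω : Type*} (Φ : Ω → Set Plane) (x : Plane) : Set Ω :=
  {ω | ∃ a, IsNearest (Φ ω) a ∧ x ∈ voronoiCell (Φ ω) a}

/-- The conditional probability that `x` lies in the Voronoi cell of the closest point of `Φ` to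
the origin, given that this closest point is at distance less than `ε` from `xs`. -/
def pcaApprox {Ω : Type*} [MeasurableSpace Ω] (P : Measure Ω) (Φ : Ω → Set Plane)
    (x xs : Plane) (ε : ℝ) : ℝ :=
  (ProbabilityTheory.cond P (nearestIn Φ (Metric.ball xs ε))).real (inGuardRegion Φ x)

/-- The probabilistic cell area function `p_c(x ∣ x^*)`, the probability that `x` lies in the
Voronoi cell of the closest point of `Φ` to the origin, conditioned on this point being `xs`.
The condition has probability zero; as usual, conditioning on it is the limit of conditioning on
the closest point lying in the ball of radius `ε` about `xs`. For `xs = 0` this conditions on a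
point of `Φ` being at the origin. -/
def pca {Ω : Type*} [MeasurableSpace Ω] (P : Measure Ω) (Φ : Ω → Set Plane)
    (x xs : Plane) : ℝ :=
  limUnder (𝓝[>] (0 : ℝ)) (pcaApprox P Φ x xs)

/-- The equivalent density `λ_{x_R,u}(r)`, given `x^* = xs`, for the receiver position `xR` and
the UE density `lamU`. -/
def ueDensity {Ω : Type*} [MeasurableSpace Ω] (P : Measure Ω) (Φ : Ω → Set Plane)
    (lamU : ℝ) (xs xR : Plane) (r : ℝ) : ℝ :=
  lamU * (1 - 1 / (2 * Real.pi) *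
    ∫ θ in (0 : ℝ)..(2 * Real.pi), pca P Φ (polarPoint r θ + xR) xs)

end

/-! Given that the nearest AP is `xs`, the disc about the origin through `xs` is empty and the
process outside it is still Poisson. So `x` lies in the cell of `xs` exactly when `exposedDisc x xs`
is empty, which gives `pca = exp (-lam * |exposedDisc x xs|)` (`pca_eq`). For `x` at distance `r`
from `xs` this region is part of a disc of area `π r ^ 2`, whence the bound. Equality at every angle
holds for `xs = 0`; for `xs ≠ 0` and `r > 0` the two discs overlap in positive area for an open set
of angles, and the angular average is strictly larger.

The limit in `ε` is a squeeze. Conditioning on the nearest point lying in the small disc `D = ball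
xs ε` is compared with the event `isolatedIn` that `D` holds the only point of `A = ball 0 (‖xs‖ +
ε)`. That event has an explicit probability and is independent of the process outside `A`; the
discrepancy is of smaller order (`isolationError`). -/

/-! ### Nearest points, measurability and Poisson counts -/

theorem exists_rat_isolating_nearest {S : Set Plane}
    (hS : ∀ B : Set Plane, Bornology.IsBounded B → (S ∩ B).Finite) {a : Plane}
    (ha : IsNearest S a) : ∃ q : ℚ, S ∩ Metric.ball 0 (q : ℝ) = {a} := by
  have hfin : (S ∩ Metric.ball 0 (‖a‖ + 1)).Finite := hS _ Metric.isBounded_ball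
  -- Only finitely many points compete, so their norms leave a gap above `‖a‖`.
  have hev : ∀ᶠ t in 𝓝[>] ‖a‖, ∀ z ∈ S ∩ Metric.ball 0 (‖a‖ + 1), z ≠ a → t < ‖z‖ := by
    rw [eventually_all_finite hfin]
    intro z hz
    by_cases hza : z = a
    · simp [hza]
    · filter_upwards [nhdsWithin_le_nhds (Iio_mem_nhds (ha.2 z hz.1 hza))] with t ht _ using ht
  have hev' : ∀ᶠ t in 𝓝[>] ‖a‖, t < ‖a‖ + 1 :=
    nhdsWithin_le_nhds (Iio_mem_nhds (lt_add_one ‖a‖))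
  obtain ⟨t, ⟨ht1, ht2⟩, ht3⟩ := ((hev.and hev').and self_mem_nhdsWithin).exists
  obtain ⟨q, hq1, hq2⟩ := exists_rat_btwn (show ‖a‖ < t from ht3)
  refine ⟨q, Set.eq_singleton_iff_unique_mem.2 ⟨⟨ha.1, by simpa using hq1⟩, fun z hz => ?_⟩⟩
  by_contra hza
  have hz2 : ‖z‖ < q := by simpa using hz.2
  have := ht1 z ⟨hz.1, by simp only [mem_ball_zero_iff]; linarith⟩ hza
  linarith

theorem isNearest_of_inter_ball_eq {S : Set Plane} {a : Plane} {t : ℝ}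
    (h : S ∩ Metric.ball 0 t = {a}) : IsNearest S a := by
  have ha : a ∈ S ∩ Metric.ball 0 t := by rw [h]; rfl
  refine ⟨ha.1, fun z hz hza => ?_⟩
  by_contra hlt
  have h1 : ‖a‖ < t := by simpa using ha.2
  have : z ∈ S ∩ Metric.ball 0 t := ⟨hz, by simp only [mem_ball_zero_iff]; linarith⟩
  rw [h] at this
  exact hza this

section

variable {Ω : Type*} [MeasurableSpace Ω] {P : Measure Ω} {Φ : Ω → Set Plane} {lam : ℝ}

namespace IsHPPP

/-- Some rational radius isolates the nearest point, so counts alone express the event as a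
countable union; measurability follows. -/
theorem nearestIn_eq_iUnion (hΦ : IsHPPP P Φ lam) (B : Set Plane) :
    nearestIn Φ B = ⋃ q : ℚ, {ω | (Φ ω ∩ Metric.ball 0 (q : ℝ)).ncard = 1} ∩
      {ω | (Φ ω ∩ (B ∩ Metric.ball 0 (q : ℝ))).ncard = 1} := by
  ext ω
  simp only [nearestIn, Set.mem_ofPred_eq, Set.mem_iUnion, Set.mem_inter_iff]
  constructor
  · rintro ⟨a, haB, ha⟩
    obtain ⟨q, hq⟩ := exists_rat_isolating_nearest (hΦ.finite_inter ω) ha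
    refine ⟨q, by simp [hq], ?_⟩
    rw [Set.inter_left_comm, hq, Set.inter_singleton_of_mem haB, Set.ncard_singleton]
  · rintro ⟨q, h1, h2⟩
    obtain ⟨a, ha⟩ := Set.ncard_eq_one.1 h1
    rw [Set.inter_left_comm, ha] at h2
    obtain ⟨b, hb⟩ := Set.ncard_eq_one.1 h2
    have hbm : b ∈ B ∩ {a} := by rw [hb]; rfl
    obtain rfl : b = a := hbm.2
    exact ⟨b, hbm.1, isNearest_of_inter_ball_eq ha⟩

theorem measurableSet_count_eq (hΦ : IsHPPP P Φ lam) {B : Set Plane} (hB : MeasurableSet B)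
    (hb : Bornology.IsBounded B) (n : ℕ) : MeasurableSet {ω | (Φ ω ∩ B).ncard = n} :=
  hΦ.measurable_count B hB hb (measurableSet_singleton n)

theorem measurableSet_nearestIn (hΦ : IsHPPP P Φ lam) {B : Set Plane} (hB : MeasurableSet B) :
    MeasurableSet (nearestIn Φ B) := by
  rw [hΦ.nearestIn_eq_iUnion]
  exact MeasurableSet.iUnion fun q =>
    (hΦ.measurableSet_count_eq Metric.isOpen_ball.measurableSet Metric.isBounded_ball 1).inter
    (hΦ.measurableSet_count_eq (hB.inter Metric.isOpen_ball.measurableSet)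
      (Metric.isBounded_ball.subset Set.inter_subset_right) 1)

theorem real_count_eq (hΦ : IsHPPP P Φ lam) (hlam : 0 ≤ lam) {B : Set Plane}
    (hB : MeasurableSet B) (hb : Bornology.IsBounded B) (n : ℕ) :
    P.real {ω | (Φ ω ∩ B).ncard = n} =
      Real.exp (-(lam * volume.real B)) * (lam * volume.real B) ^ n / n.factorial := by
  have h := hΦ.count_law B hB hb
  have h2 : (P.map fun ω => (Φ ω ∩ B).ncard).real {n} = P.real {ω | (Φ ω ∩ B).ncard = n} := by
    rw [map_measureReal_apply (hΦ.measurable_count B hB hb) (measurableSet_singleton n)]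
    rfl
  rw [← h2, h, ProbabilityTheory.poissonMeasure_real_singleton,
    Real.coe_toNNReal _ (mul_nonneg hlam measureReal_nonneg)]

theorem real_count_one_zero_zero (hΦ : IsHPPP P Φ lam) (hlam : 0 ≤ lam) {D E L : Set Plane}
    (hD : MeasurableSet D) (hDb : Bornology.IsBounded D) (hE : MeasurableSet E)
    (hEb : Bornology.IsBounded E) (hL : MeasurableSet L) (hLb : Bornology.IsBounded L)
    (hDE : Disjoint D E) (hDL : Disjoint D L) (hEL : Disjoint E L) :
    P.real ({ω | (Φ ω ∩ D).ncard = 1 ∧ (Φ ω ∩ E).ncard = 0} ∩ {ω | (Φ ω ∩ L).ncard = 0}) =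
      lam * volume.real D * Real.exp (-(lam * (volume.real D + volume.real E))) *
        Real.exp (-(lam * volume.real L)) := by
  have hi := hΦ.count_indep 3 ![D, E, L] (by simp [Fin.forall_fin_succ, hD, hE, hL])
    (by simp [Fin.forall_fin_succ, hDb, hEb, hLb])
    (by
      intro i j hij
      fin_cases i <;> fin_cases j <;> simp_all [disjoint_comm])
  have h := hi.measure_inter_preimage_eq_mul Finset.univ (sets := ![{1}, {0}, {0}])
    (fun i _ => MeasurableSet.of_discrete)
  have hs : (⋂ i ∈ (Finset.univ : Finset (Fin 3)),
      (fun ω => (Φ ω ∩ ![D, E, L] i).ncard) ⁻¹' (![{1}, {0}, {0}] : Fin 3 → Set ℕ) i) =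
      {ω | (Φ ω ∩ D).ncard = 1 ∧ (Φ ω ∩ E).ncard = 0} ∩ {ω | (Φ ω ∩ L).ncard = 0} := by
    ext ω
    simp only [Finset.mem_univ, Set.iInter_true, Set.mem_iInter, Fin.forall_fin_succ,
      Set.mem_preimage, Set.mem_inter_iff, Set.mem_ofPred_eq, and_assoc]
    simp [-Set.ncard_eq_zero]
  rw [hs, Fin.prod_univ_three] at h
  have h' : P.real ({ω | (Φ ω ∩ D).ncard = 1 ∧ (Φ ω ∩ E).ncard = 0} ∩
      {ω | (Φ ω ∩ L).ncard = 0}) = P.real {ω | (Φ ω ∩ D).ncard = 1} *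
      P.real {ω | (Φ ω ∩ E).ncard = 0} * P.real {ω | (Φ ω ∩ L).ncard = 0} := by
    rw [measureReal_def, measureReal_def, measureReal_def, measureReal_def, ← ENNReal.toReal_mul,
      ← ENNReal.toReal_mul]
    exact congrArg ENNReal.toReal h
  rw [h', hΦ.real_count_eq hlam hD hDb, hΦ.real_count_eq hlam hE hEb,
    hΦ.real_count_eq hlam hL hLb, mul_add, neg_add, Real.exp_add]
  simp
  ring

variable [IsProbabilityMeasure P]

theorem real_one_le_count_le (hΦ : IsHPPP P Φ lam) (hlam : 0 ≤ lam) {B : Set Plane}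
    (hB : MeasurableSet B) (hb : Bornology.IsBounded B) :
    P.real {ω | 1 ≤ (Φ ω ∩ B).ncard} ≤ lam * volume.real B := by
  have hc : {ω | 1 ≤ (Φ ω ∩ B).ncard} = {ω | (Φ ω ∩ B).ncard = 0}ᶜ := by
    ext ω
    simp only [Set.mem_ofPred_eq, Set.mem_compl_iff]
    omega
  rw [hc, measureReal_compl (hΦ.measurableSet_count_eq hB hb 0), hΦ.real_count_eq hlam hB hb]
  have := Real.add_one_le_exp (-(lam * volume.real B))
  simp
  linarith

theorem real_two_le_count_le (hΦ : IsHPPP P Φ lam) (hlam : 0 ≤ lam) {B : Set Plane}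
    (hB : MeasurableSet B) (hb : Bornology.IsBounded B) :
    P.real {ω | 2 ≤ (Φ ω ∩ B).ncard} ≤ (lam * volume.real B) ^ 2 := by
  have hc : {ω | 2 ≤ (Φ ω ∩ B).ncard} =
      ({ω | (Φ ω ∩ B).ncard = 0} ∪ {ω | (Φ ω ∩ B).ncard = 1})ᶜ := by
    ext ω
    simp only [Set.mem_ofPred_eq, Set.mem_compl_iff, Set.mem_union]
    omega
  have hd : Disjoint {ω | (Φ ω ∩ B).ncard = 0} {ω | (Φ ω ∩ B).ncard = 1} := by
    refine Set.disjoint_left.2 fun ω h0 h1 => ?_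
    simp only [Set.mem_ofPred_eq] at h0 h1
    omega
  have m0 := hΦ.measurableSet_count_eq hB hb 0
  have m1 := hΦ.measurableSet_count_eq hB hb 1
  rw [hc, measureReal_compl (m0.union m1), measureReal_union hd m1, hΦ.real_count_eq hlam hB hb,
    hΦ.real_count_eq hlam hB hb]
  -- With `m` the mean, `(1 + m) * exp (-m) ≥ (1 + m) * (1 - m) = 1 - m ^ 2`.
  have h := Real.add_one_le_exp (-(lam * volume.real B))
  have h0 : 0 ≤ lam * volume.real B := mul_nonneg hlam measureReal_nonneg
  simp
  nlinarith

theorem real_one_le_count_inter_le (hΦ : IsHPPP P Φ lam) (hlam : 0 ≤ lam) {B C : Set Plane}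
    (hB : MeasurableSet B) (hb : Bornology.IsBounded B) (hC : MeasurableSet C)
    (hc : Bornology.IsBounded C) (hBC : Disjoint B C) :
    P.real ({ω | 1 ≤ (Φ ω ∩ B).ncard} ∩ {ω | 1 ≤ (Φ ω ∩ C).ncard}) ≤
      (lam * volume.real B) * (lam * volume.real C) := by
  have hi := (hΦ.count_indep 2 ![B, C] (by simp [Fin.forall_fin_two, hB, hC])
    (by simp [Fin.forall_fin_two, hb, hc])
    (by
      intro i j hij
      fin_cases i <;> fin_cases j <;> simp_all [disjoint_comm])).indepFun
    (show (0 : Fin 2) ≠ 1 by decide)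
  have h := hi.measure_inter_preimage_eq_mul (Set.Ici 1) (Set.Ici 1) measurableSet_Ici
    measurableSet_Ici
  have h' : P.real ({ω | 1 ≤ (Φ ω ∩ B).ncard} ∩ {ω | 1 ≤ (Φ ω ∩ C).ncard}) =
      P.real {ω | 1 ≤ (Φ ω ∩ B).ncard} * P.real {ω | 1 ≤ (Φ ω ∩ C).ncard} := by
    rw [measureReal_def, measureReal_def, measureReal_def, ← ENNReal.toReal_mul]
    exact congrArg ENNReal.toReal h
  rw [h']
  exact mul_le_mul (hΦ.real_one_le_count_le hlam hB hb) (hΦ.real_one_le_count_le hlam hC hc)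
    measureReal_nonneg (mul_nonneg hlam measureReal_nonneg)

end IsHPPP

end

/-! ### Isolation of the nearest point -/

/-- Truncating at `0` keeps the area continuous in every real radius, so `‖xs‖ - ε`, negative when
`xs = 0` and `ε > 0`, needs no separate case. -/
theorem volume_real_ball_plane (x : Plane) (r : ℝ) :
    volume.real (Metric.ball x r) = Real.pi * max r 0 ^ 2 := by
  rw [measureReal_def, EuclideanSpace.volume_ball_fin_two, ENNReal.toReal_mul, ENNReal.toReal_pow,
    ENNReal.toReal_ofReal Real.pi_pos.le, ENNReal.toReal_ofReal']
  ring

theorem volume_real_ball_diff_ball (x : Plane) {r t : ℝ} (h : r ≤ t) :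
    volume.real (Metric.ball x t \ Metric.ball x r) =
      volume.real (Metric.ball x t) - volume.real (Metric.ball x r) :=
  measureReal_sdiff (Metric.ball_subset_ball h) Metric.isOpen_ball.measurableSet
    (Metric.isBounded_ball.measure_lt_top.ne)

theorem ball_subset_ball_zero_norm_add (a : Plane) (ε : ℝ) :
    Metric.ball a ε ⊆ Metric.ball 0 (‖a‖ + ε) :=
  Metric.ball_subset_ball' (by simp [add_comm])

theorem IsNearest.unique {S : Set Plane} {a b : Plane} (ha : IsNearest S a) (hb : IsNearest S b) :
    a = b := by
  by_contra h
  have h1 := ha.2 b hb.1 (Ne.symm h)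
  have h2 := hb.2 a ha.1 h
  linarith

/-- The event that `B` contains exactly one point of `Φ` and `A \ B` contains none. -/
def isolatedIn {Ω : Type*} (Φ : Ω → Set Plane) (B A : Set Plane) : Set Ω :=
  {ω | (Φ ω ∩ B).ncard = 1 ∧ (Φ ω ∩ (A \ B)).ncard = 0}

/-- An upper bound for the probability that the closest point to the origin lies in the ball of
radius `ε` about `xs` but is not the only point in the ball of radius `‖xs‖ + ε` about the origin,
relative to the probability that it is. -/
noncomputable def isolationError (lam : ℝ) (xs : Plane) (ε : ℝ) : ℝ :=
  (lam * volume.real (Metric.ball xs ε) +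
    lam * (volume.real (Metric.ball (0 : Plane) (‖xs‖ + ε)) -
      volume.real (Metric.ball (0 : Plane) (‖xs‖ - ε)))) *
    Real.exp (lam * volume.real (Metric.ball (0 : Plane) (‖xs‖ + ε)))

theorem tendsto_isolationError (lam : ℝ) (xs : Plane) :
    Tendsto (isolationError lam xs) (𝓝[>] 0) (𝓝 0) := by
  have hc : Continuous (isolationError lam xs) := by
    unfold isolationError
    simp_rw [volume_real_ball_plane]
    fun_prop
  have := hc.tendsto 0
  simp only [isolationError, Metric.ball_zero, measureReal_empty, add_zero, sub_zero, sub_self,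
    mul_zero, zero_mul] at this
  exact this.mono_left nhdsWithin_le_nhds

section

variable {Ω : Type*} [MeasurableSpace Ω] {P : Measure Ω} {Φ : Ω → Set Plane} {lam : ℝ}

namespace IsHPPP

theorem exists_of_mem_isolatedIn (hΦ : IsHPPP P Φ lam) {xs : Plane} {ε : ℝ} {ω : Ω}
    (h : ω ∈ isolatedIn Φ (Metric.ball xs ε) (Metric.ball 0 (‖xs‖ + ε))) :
    ∃ a ∈ Metric.ball xs ε, Φ ω ∩ Metric.ball 0 (‖xs‖ + ε) = {a} := by
  obtain ⟨h1, h2⟩ := h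
  obtain ⟨a, ha⟩ := Set.ncard_eq_one.1 h1
  have hm : a ∈ Φ ω ∩ Metric.ball xs ε := by rw [ha]; rfl
  -- Local finiteness rules out the default `ncard = 0` of an infinite set.
  rw [Set.ncard_eq_zero (hΦ.finite_inter ω _ (Metric.isBounded_ball.subset Set.sdiff_subset))] at h2
  refine ⟨a, hm.2, ?_⟩
  rw [← Set.sdiff_union_of_subset (ball_subset_ball_zero_norm_add xs ε),
    Set.inter_union_distrib_left, h2, ha, Set.empty_union]

theorem isolatedIn_subset_nearestIn (hΦ : IsHPPP P Φ lam) (xs : Plane) (ε : ℝ) :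
    isolatedIn Φ (Metric.ball xs ε) (Metric.ball 0 (‖xs‖ + ε)) ⊆
      nearestIn Φ (Metric.ball xs ε) := by
  intro ω h
  obtain ⟨a, ha, hS⟩ := hΦ.exists_of_mem_isolatedIn h
  exact ⟨a, ha, isNearest_of_inter_ball_eq hS⟩

/-- If `D` holds no second point, the intruder is outside `D` and farther out than the nearest
point, whose norm exceeds `‖xs‖ - ε`. It therefore lies in a thin annulus. -/
theorem nearestIn_diff_isolatedIn_subset (hΦ : IsHPPP P Φ lam) (xs : Plane) (ε : ℝ) :
    nearestIn Φ (Metric.ball xs ε) \ isolatedIn Φ (Metric.ball xs ε) (Metric.ball 0 (‖xs‖ + ε)) ⊆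
      {ω | 2 ≤ (Φ ω ∩ Metric.ball xs ε).ncard} ∪
      ({ω | 1 ≤ (Φ ω ∩ Metric.ball xs ε).ncard} ∩
        {ω | 1 ≤ (Φ ω ∩ ((Metric.ball 0 (‖xs‖ + ε) \ Metric.ball 0 (‖xs‖ - ε)) \
          Metric.ball xs ε)).ncard}) := by
  rintro ω ⟨⟨a, haD, ha⟩, hG⟩
  have h1 : 1 ≤ (Φ ω ∩ Metric.ball xs ε).ncard :=
    (Set.ncard_pos (hΦ.finite_inter ω _ Metric.isBounded_ball)).2 ⟨a, ha.1, haD⟩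
  by_cases h2 : 2 ≤ (Φ ω ∩ Metric.ball xs ε).ncard
  · exact Or.inl h2
  refine Or.inr ⟨h1, ?_⟩
  have h3 : (Φ ω ∩ (Metric.ball 0 (‖xs‖ + ε) \ Metric.ball xs ε)).ncard ≠ 0 :=
    fun h => hG ⟨by omega, h⟩
  obtain ⟨z, hz, hzA, hzD⟩ := Set.nonempty_of_ncard_ne_zero h3
  refine (Set.ncard_pos (hΦ.finite_inter ω _ ((Metric.isBounded_ball.subset
    Set.sdiff_subset).subset Set.sdiff_subset))).2 ⟨z, hz, ⟨hzA, fun hzC => ?_⟩, hzD⟩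
  have hlt := ha.2 z hz (by rintro rfl; exact hzD haD)
  rw [mem_ball_zero_iff] at hzC
  rw [mem_ball_iff_norm] at haD
  have := norm_sub_norm_le xs a
  rw [norm_sub_rev] at this
  linarith

/-- The nearest point is within `ε` of `xs`, hence closer to `x` than any point outside the enlarged
disc; inside `A` it has no rival. -/
theorem isolatedIn_inter_void_subset (hΦ : IsHPPP P Φ lam) (x xs : Plane) (ε : ℝ) :
    isolatedIn Φ (Metric.ball xs ε) (Metric.ball 0 (‖xs‖ + ε)) ∩
      {ω | (Φ ω ∩ (Metric.ball x (‖x - xs‖ + ε) \ Metric.ball 0 (‖xs‖ + ε))).ncard = 0} ⊆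
      nearestIn Φ (Metric.ball xs ε) ∩ inGuardRegion Φ x := by
  rintro ω ⟨hG, hU⟩
  refine ⟨hΦ.isolatedIn_subset_nearestIn xs ε hG, ?_⟩
  obtain ⟨a, ha, hS⟩ := hΦ.exists_of_mem_isolatedIn hG
  refine ⟨a, isNearest_of_inter_ball_eq hS, fun z hz => ?_⟩
  rw [Set.mem_ofPred_eq, Set.ncard_eq_zero
    (hΦ.finite_inter ω _ (Metric.isBounded_ball.subset Set.sdiff_subset))] at hU
  by_contra hlt
  rw [mem_ball_iff_norm] at ha
  have htri : ‖x - a‖ ≤ ‖x - xs‖ + ‖a - xs‖ := by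
    rw [norm_sub_rev a]
    exact norm_sub_le_norm_sub_add_norm_sub x xs a
  have hzx : z ∈ Metric.ball x (‖x - xs‖ + ε) := by
    rw [mem_ball_iff_norm, norm_sub_rev]
    linarith
  have hzA : z ∉ Metric.ball 0 (‖xs‖ + ε) := by
    intro h
    have : z ∈ Φ ω ∩ Metric.ball 0 (‖xs‖ + ε) := ⟨hz.1, h⟩
    rw [hS] at this
    exact hz.2 this
  have : z ∈ (∅ : Set Plane) := by
    rw [← hU]
    exact ⟨hz.1, hzx, hzA⟩
  exact this

/-- Conversely, a point in the shrunken disc would be closer to `x` than the nearest point is. -/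
theorem isolatedIn_inter_inGuardRegion_subset (hΦ : IsHPPP P Φ lam) (x xs : Plane) (ε : ℝ) :
    isolatedIn Φ (Metric.ball xs ε) (Metric.ball 0 (‖xs‖ + ε)) ∩ inGuardRegion Φ x ⊆
    isolatedIn Φ (Metric.ball xs ε) (Metric.ball 0 (‖xs‖ + ε)) ∩
      {ω | (Φ ω ∩ (Metric.ball x (‖x - xs‖ - ε) \ Metric.ball 0 (‖xs‖ + ε))).ncard = 0} := by
  rintro ω ⟨hG, b, hb, hV⟩
  refine ⟨hG, ?_⟩
  obtain ⟨a, ha, hS⟩ := hΦ.exists_of_mem_isolatedIn hG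
  obtain rfl := (isNearest_of_inter_ball_eq hS).unique hb
  rw [Set.mem_ofPred_eq, Set.ncard_eq_zero
    (hΦ.finite_inter ω _ (Metric.isBounded_ball.subset Set.sdiff_subset)),
    Set.eq_empty_iff_forall_notMem]
  rintro z ⟨hz, hzx, hzA⟩
  have hza : z ≠ a := by
    rintro rfl
    exact hzA (ball_subset_ball_zero_norm_add _ _ ha)
  have h1 := hV z ⟨hz, hza⟩
  rw [mem_ball_iff_norm, norm_sub_rev] at hzx
  rw [mem_ball_iff_norm] at ha
  have := norm_sub_le_norm_sub_add_norm_sub x a xs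
  linarith

theorem real_isolatedIn_inter_void (hΦ : IsHPPP P Φ lam) (hlam : 0 ≤ lam) (xs : Plane) (ε : ℝ)
    {L : Set Plane} (hL : MeasurableSet L) (hLb : Bornology.IsBounded L)
    (hAL : Disjoint (Metric.ball 0 (‖xs‖ + ε)) L) :
    P.real (isolatedIn Φ (Metric.ball xs ε) (Metric.ball 0 (‖xs‖ + ε)) ∩
      {ω | (Φ ω ∩ L).ncard = 0}) =
      lam * volume.real (Metric.ball xs ε) *
        Real.exp (-(lam * volume.real (Metric.ball (0 : Plane) (‖xs‖ + ε)))) *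
        Real.exp (-(lam * volume.real L)) := by
  have hsub := ball_subset_ball_zero_norm_add xs ε
  rw [isolatedIn, hΦ.real_count_one_zero_zero hlam Metric.isOpen_ball.measurableSet
    Metric.isBounded_ball (Metric.isOpen_ball.measurableSet.diff Metric.isOpen_ball.measurableSet)
    (Metric.isBounded_ball.subset Set.sdiff_subset) hL hLb Set.disjoint_sdiff_right
    (hAL.mono_left hsub) (hAL.mono_left Set.sdiff_subset),
    measureReal_sdiff hsub Metric.isOpen_ball.measurableSet
      (Metric.isBounded_ball.measure_lt_top.ne)]
  ring_nf

theorem real_isolatedIn (hΦ : IsHPPP P Φ lam) (hlam : 0 ≤ lam) (xs : Plane) (ε : ℝ) :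
    P.real (isolatedIn Φ (Metric.ball xs ε) (Metric.ball 0 (‖xs‖ + ε))) =
      lam * volume.real (Metric.ball xs ε) *
        Real.exp (-(lam * volume.real (Metric.ball (0 : Plane) (‖xs‖ + ε)))) := by
  have h := hΦ.real_isolatedIn_inter_void hlam xs ε MeasurableSet.empty Bornology.isBounded_empty
    (Set.disjoint_empty _)
  simpa using h

variable [IsProbabilityMeasure P]

/-- Both exceptional events need two points, one of them in `D`, so their bounds carry a factor `lam
* |D|`. Dividing by `P(isolatedIn) = lam * |D| * exp (-lam * |A|)` leaves `isolationError`. -/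
theorem real_nearestIn_diff_isolatedIn_le (hΦ : IsHPPP P Φ lam) (hlam : 0 ≤ lam) (xs : Plane)
    {ε : ℝ} (hε : 0 ≤ ε) :
    P.real (nearestIn Φ (Metric.ball xs ε) \
      isolatedIn Φ (Metric.ball xs ε) (Metric.ball 0 (‖xs‖ + ε))) ≤
      P.real (isolatedIn Φ (Metric.ball xs ε) (Metric.ball 0 (‖xs‖ + ε))) *
        isolationError lam xs ε := by
  have mb : ∀ (x : Plane) (r : ℝ), MeasurableSet (Metric.ball x r) :=
    fun x r => Metric.isOpen_ball.measurableSet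
  refine (measureReal_mono (hΦ.nearestIn_diff_isolatedIn_subset xs ε)).trans
    ((measureReal_union_le _ _).trans ?_)
  have h1 := hΦ.real_two_le_count_le hlam (mb xs ε) Metric.isBounded_ball
  have h2 := hΦ.real_one_le_count_inter_le hlam (mb xs ε) Metric.isBounded_ball
    (((mb 0 (‖xs‖ + ε)).diff (mb 0 (‖xs‖ - ε))).diff (mb xs ε))
    ((Metric.isBounded_ball.subset Set.sdiff_subset).subset Set.sdiff_subset)
    Set.disjoint_sdiff_right
  have h3 : volume.real ((Metric.ball 0 (‖xs‖ + ε) \ Metric.ball 0 (‖xs‖ - ε)) \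
      Metric.ball xs ε) ≤ volume.real (Metric.ball (0 : Plane) (‖xs‖ + ε)) -
      volume.real (Metric.ball (0 : Plane) (‖xs‖ - ε)) := by
    rw [← volume_real_ball_diff_ball _ (by linarith)]
    exact measureReal_mono Set.sdiff_subset
      (Metric.isBounded_ball.subset Set.sdiff_subset).measure_lt_top.ne
  rw [hΦ.real_isolatedIn hlam, isolationError, Real.exp_neg]
  have hd : 0 ≤ lam * volume.real (Metric.ball xs ε) := mul_nonneg hlam measureReal_nonneg
  have h4 := mul_le_mul_of_nonneg_left (mul_le_mul_of_nonneg_left h3 hlam) hd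
  have hne := Real.exp_ne_zero (lam * volume.real (Metric.ball (0 : Plane) (‖xs‖ + ε)))
  refine (add_le_add h1 (h2.trans h4)).trans (le_of_eq ?_)
  field_simp

end IsHPPP

end

/-! ### Areas of the perturbed exposed disc -/

/-- The part of the disc about `x` through `xs` that lies outside the disc about the origin
through `xs`: given that `xs` is the closest point to the origin, `x` lies in its cell if and only
if this region contains no point. -/
def exposedDisc (x xs : Plane) : Set Plane := Metric.ball x ‖x - xs‖ \ Metric.ball 0 ‖xs‖

theorem isBounded_exposedDisc (x xs : Plane) : Bornology.IsBounded (exposedDisc x xs) :=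
  Metric.isBounded_ball.subset Set.sdiff_subset

theorem volume_real_outer_le (x xs : Plane) {ε : ℝ} (hε : 0 ≤ ε) :
    volume.real (Metric.ball x (‖x - xs‖ + ε) \ Metric.ball 0 (‖xs‖ + ε)) ≤
      volume.real (exposedDisc x xs) + (volume.real (Metric.ball x (‖x - xs‖ + ε)) -
        volume.real (Metric.ball x ‖x - xs‖)) := by
  rw [← volume_real_ball_diff_ball _ (by linarith)]
  refine (measureReal_mono ?_ ?_).trans (measureReal_union_le _ _)
  · rintro z ⟨h1, h2⟩
    by_cases h : z ∈ Metric.ball x ‖x - xs‖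
    · exact Or.inl ⟨h, fun h3 => h2 (Metric.ball_subset_ball (by linarith) h3)⟩
    · exact Or.inr ⟨h1, h⟩
  · exact ((isBounded_exposedDisc x xs).union
      (Metric.isBounded_ball.subset Set.sdiff_subset)).measure_lt_top.ne

/-- Shrinking the disc about `x` and enlarging the removed disc each cost at most a thin annulus. -/
theorem le_volume_real_inner (x xs : Plane) {ε : ℝ} (hε : 0 ≤ ε) :
    volume.real (exposedDisc x xs) - (volume.real (Metric.ball x ‖x - xs‖) -
        volume.real (Metric.ball x (‖x - xs‖ - ε))) -
        (volume.real (Metric.ball (0 : Plane) (‖xs‖ + ε)) -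
          volume.real (Metric.ball (0 : Plane) ‖xs‖)) ≤
      volume.real (Metric.ball x (‖x - xs‖ - ε) \ Metric.ball 0 (‖xs‖ + ε)) := by
  rw [← volume_real_ball_diff_ball _ (by linarith), ← volume_real_ball_diff_ball _ (by linarith),
    sub_sub, sub_le_iff_le_add]
  have hsub : exposedDisc x xs ⊆ (Metric.ball x (‖x - xs‖ - ε) \ Metric.ball 0 (‖xs‖ + ε)) ∪
      ((Metric.ball x ‖x - xs‖ \ Metric.ball x (‖x - xs‖ - ε)) ∪
        (Metric.ball 0 (‖xs‖ + ε) \ Metric.ball 0 ‖xs‖)) := by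
    rintro z ⟨h1, h2⟩
    by_cases h : z ∈ Metric.ball x (‖x - xs‖ - ε)
    · by_cases h' : z ∈ Metric.ball 0 (‖xs‖ + ε)
      · exact Or.inr (Or.inr ⟨h', h2⟩)
      · exact Or.inl ⟨h, h'⟩
    · exact Or.inr (Or.inl ⟨h1, h⟩)
  have hb : ∀ (y y' : Plane) (r t : ℝ), Bornology.IsBounded (Metric.ball y r \ Metric.ball y' t) :=
    fun y y' r t => Metric.isBounded_ball.subset Set.sdiff_subset
  exact (measureReal_mono hsub
    ((hb _ _ _ _).union ((hb _ _ _ _).union (hb _ _ _ _))).measure_lt_top.ne).trans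
    ((measureReal_union_le _ _).trans (add_le_add_right (measureReal_union_le _ _) _))

theorem tendsto_volume_real_outer (x xs : Plane) :
    Tendsto (fun ε : ℝ => volume.real (exposedDisc x xs) +
      (volume.real (Metric.ball x (‖x - xs‖ + ε)) - volume.real (Metric.ball x ‖x - xs‖)))
      (𝓝[>] 0) (𝓝 (volume.real (exposedDisc x xs))) := by
  have hc : Continuous (fun ε : ℝ => volume.real (exposedDisc x xs) +
      (volume.real (Metric.ball x (‖x - xs‖ + ε)) - volume.real (Metric.ball x ‖x - xs‖))) := by
    simp_rw [volume_real_ball_plane]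
    fun_prop
  have := hc.tendsto 0
  simp only [add_zero, sub_self] at this
  exact this.mono_left nhdsWithin_le_nhds

theorem tendsto_volume_real_inner (x xs : Plane) :
    Tendsto (fun ε : ℝ => volume.real (exposedDisc x xs) -
      (volume.real (Metric.ball x ‖x - xs‖) - volume.real (Metric.ball x (‖x - xs‖ - ε))) -
        (volume.real (Metric.ball (0 : Plane) (‖xs‖ + ε)) -
          volume.real (Metric.ball (0 : Plane) ‖xs‖)))
      (𝓝[>] 0) (𝓝 (volume.real (exposedDisc x xs))) := by
  have hc : Continuous (fun ε : ℝ => volume.real (exposedDisc x xs) -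
      (volume.real (Metric.ball x ‖x - xs‖) - volume.real (Metric.ball x (‖x - xs‖ - ε))) -
        (volume.real (Metric.ball (0 : Plane) (‖xs‖ + ε)) -
          volume.real (Metric.ball (0 : Plane) ‖xs‖))) := by
    simp_rw [volume_real_ball_plane]
    fun_prop
  have := hc.tendsto 0
  simp only [add_zero, sub_self, sub_zero] at this
  exact this.mono_left nhdsWithin_le_nhds

theorem isolationError_nonneg {lam : ℝ} (hlam : 0 ≤ lam) (xs : Plane) {ε : ℝ} (hε : 0 ≤ ε) :
    0 ≤ isolationError lam xs ε := by
  rw [isolationError, ← volume_real_ball_diff_ball _ (by linarith)]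
  positivity

/-! ### The conditional probability and its limit -/

section

variable {Ω : Type*} [MeasurableSpace Ω] {P : Measure Ω} {Φ : Ω → Set Plane} {lam : ℝ}

namespace IsHPPP

/-- Only the conditioning event must be measurable; `inGuardRegion` is later handled by monotonicity
and subadditivity. -/
theorem pcaApprox_eq_div (hΦ : IsHPPP P Φ lam) (x xs : Plane) (ε : ℝ) :
    pcaApprox P Φ x xs ε = P.real (nearestIn Φ (Metric.ball xs ε) ∩ inGuardRegion Φ x) /
      P.real (nearestIn Φ (Metric.ball xs ε)) := by
  rw [pcaApprox, measureReal_def, ProbabilityTheory.cond_apply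
    (hΦ.measurableSet_nearestIn Metric.isOpen_ball.measurableSet), ENNReal.toReal_mul,
    ENNReal.toReal_inv, ← measureReal_def, ← measureReal_def, mul_comm, div_eq_mul_inv]

theorem real_isolatedIn_pos (hΦ : IsHPPP P Φ lam) (hlam : 0 < lam) (xs : Plane) {ε : ℝ}
    (hε : 0 < ε) : 0 < P.real (isolatedIn Φ (Metric.ball xs ε) (Metric.ball 0 (‖xs‖ + ε))) := by
  rw [hΦ.real_isolatedIn hlam.le, volume_real_ball_plane, max_eq_left hε.le]
  have := Real.pi_pos
  positivity

variable [IsProbabilityMeasure P]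

/-- The denominator is at most `P(isolatedIn) * (1 + isolationError)`, and the numerator contains an
independent void event. -/
theorem le_pcaApprox (hΦ : IsHPPP P Φ lam) (hlam : 0 < lam) (x xs : Plane) {ε : ℝ} (hε : 0 < ε) :
    Real.exp (-(lam * volume.real (Metric.ball x (‖x - xs‖ + ε) \ Metric.ball 0 (‖xs‖ + ε)))) /
      (1 + isolationError lam xs ε) ≤ pcaApprox P Φ x xs ε := by
  have hg := hΦ.real_isolatedIn_pos hlam xs hε
  have hnum := measureReal_mono (μ := P) (hΦ.isolatedIn_inter_void_subset x xs ε)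
  rw [hΦ.real_isolatedIn_inter_void hlam.le xs ε
    (Metric.isOpen_ball.measurableSet.diff Metric.isOpen_ball.measurableSet)
    (Metric.isBounded_ball.subset Set.sdiff_subset) Set.disjoint_sdiff_right,
    ← hΦ.real_isolatedIn hlam.le] at hnum
  have hN := measureReal_mono (μ := P) (hΦ.isolatedIn_subset_nearestIn xs ε)
  have hle : P.real (nearestIn Φ (Metric.ball xs ε)) ≤ _ :=
    (measureReal_mono (Set.subset_union_right.trans Set.union_sdiff_self.ge)).trans
      (measureReal_union_le (isolatedIn Φ (Metric.ball xs ε) (Metric.ball 0 (‖xs‖ + ε))) _)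
  have hden := hle.trans (add_le_add_right (hΦ.real_nearestIn_diff_isolatedIn_le hlam.le xs hε.le) _)
  have hβ := isolationError_nonneg hlam.le xs hε.le
  rw [hΦ.pcaApprox_eq_div, div_le_div_iff₀ (by linarith) (hg.trans_le hN)]
  have he := Real.exp_pos (-(lam * volume.real (Metric.ball x (‖x - xs‖ + ε) \
    Metric.ball 0 (‖xs‖ + ε))))
  have h1 := mul_le_mul_of_nonneg_left hden he.le
  have h2 := mul_le_mul_of_nonneg_right hnum (show 0 ≤ 1 + isolationError lam xs ε by linarith)
  linarith

theorem pcaApprox_le (hΦ : IsHPPP P Φ lam) (hlam : 0 < lam) (x xs : Plane) {ε : ℝ} (hε : 0 < ε) :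
    pcaApprox P Φ x xs ε ≤ Real.exp (-(lam * volume.real (Metric.ball x (‖x - xs‖ - ε) \
      Metric.ball 0 (‖xs‖ + ε)))) + isolationError lam xs ε := by
  have hg := hΦ.real_isolatedIn_pos hlam xs hε
  have hin := measureReal_mono (μ := P) (hΦ.isolatedIn_inter_inGuardRegion_subset x xs ε)
  rw [hΦ.real_isolatedIn_inter_void hlam.le xs ε
    (Metric.isOpen_ball.measurableSet.diff Metric.isOpen_ball.measurableSet)
    (Metric.isBounded_ball.subset Set.sdiff_subset) Set.disjoint_sdiff_right,
    ← hΦ.real_isolatedIn hlam.le] at hin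
  have hN := measureReal_mono (μ := P) (hΦ.isolatedIn_subset_nearestIn xs ε)
  have hsub : nearestIn Φ (Metric.ball xs ε) ∩ inGuardRegion Φ x ⊆
      (isolatedIn Φ (Metric.ball xs ε) (Metric.ball 0 (‖xs‖ + ε)) ∩ inGuardRegion Φ x) ∪
      (nearestIn Φ (Metric.ball xs ε) \
        isolatedIn Φ (Metric.ball xs ε) (Metric.ball 0 (‖xs‖ + ε))) := by
    rintro ω ⟨h1, h2⟩
    by_cases h : ω ∈ isolatedIn Φ (Metric.ball xs ε) (Metric.ball 0 (‖xs‖ + ε))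
    · exact Or.inl ⟨h, h2⟩
    · exact Or.inr ⟨h1, h⟩
  have hnum := ((measureReal_mono (μ := P) hsub).trans (measureReal_union_le _ _)).trans
    (add_le_add hin (hΦ.real_nearestIn_diff_isolatedIn_le hlam.le xs hε.le))
  have hβ := isolationError_nonneg hlam.le xs hε.le
  have he := Real.exp_pos (-(lam * volume.real (Metric.ball x (‖x - xs‖ - ε) \
    Metric.ball 0 (‖xs‖ + ε))))
  rw [hΦ.pcaApprox_eq_div, div_le_iff₀ (hg.trans_le hN)]
  have h1 := mul_le_mul_of_nonneg_left hN (add_nonneg he.le hβ)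
  linarith

theorem tendsto_pcaApprox (hΦ : IsHPPP P Φ lam) (hlam : 0 < lam) (x xs : Plane) :
    Tendsto (pcaApprox P Φ x xs) (𝓝[>] 0)
      (𝓝 (Real.exp (-(lam * volume.real (exposedDisc x xs))))) := by
  have hlow := (((tendsto_volume_real_outer x xs).const_mul lam).neg.rexp).div
    ((tendsto_isolationError lam xs).const_add 1) (by norm_num)
  have hup := (((tendsto_volume_real_inner x xs).const_mul lam).neg.rexp).add
    (tendsto_isolationError lam xs)
  rw [add_zero, div_one] at hlow
  rw [add_zero] at hup
  refine tendsto_of_tendsto_of_tendsto_of_le_of_le' hlow hup ?_ ?_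
  · filter_upwards [self_mem_nhdsWithin] with ε hε
    have hε : 0 < ε := hε
    have hβ := isolationError_nonneg hlam.le xs hε.le
    refine le_trans ?_ (hΦ.le_pcaApprox hlam x xs hε)
    refine div_le_div_of_nonneg_right (Real.exp_le_exp.2 (neg_le_neg ?_)) (by linarith)
    exact mul_le_mul_of_nonneg_left (volume_real_outer_le x xs hε.le) hlam.le
  · filter_upwards [self_mem_nhdsWithin] with ε hε
    have hε : 0 < ε := hε
    refine (hΦ.pcaApprox_le hlam x xs hε).trans
      (add_le_add_left (Real.exp_le_exp.2 (neg_le_neg ?_)) _)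
    exact mul_le_mul_of_nonneg_left (le_volume_real_inner x xs hε.le) hlam.le

/-- Convergence is what rules out the default value of `limUnder`. -/
theorem pca_eq (hΦ : IsHPPP P Φ lam) (hlam : 0 < lam) (x xs : Plane) :
    pca P Φ x xs = Real.exp (-(lam * volume.real (exposedDisc x xs))) :=
  (hΦ.tendsto_pcaApprox hlam x xs).limUnder_eq

end IsHPPP

end

/-! ### Geometry of the exposed disc -/

theorem norm_polarPoint (r θ : ℝ) : ‖polarPoint r θ‖ = |r| := by
  rw [EuclideanSpace.norm_eq, ← Real.sqrt_sq_eq_abs]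
  congr 1
  simp only [polarPoint, Fin.sum_univ_two, Real.norm_eq_abs, sq_abs]
  simp
  linear_combination r ^ 2 * Real.sin_sq_add_cos_sq θ

theorem inner_polarPoint (a : Plane) (r θ : ℝ) :
    inner ℝ a (polarPoint r θ) = r * (a 0 * Real.cos θ + a 1 * Real.sin θ) := by
  simp [polarPoint, PiLp.inner_apply, Fin.sum_univ_two]
  ring

theorem continuous_polarPoint (r : ℝ) : Continuous (polarPoint r) := by
  unfold polarPoint
  fun_prop

theorem volume_real_exposedDisc_le (x xs : Plane) :
    volume.real (exposedDisc x xs) ≤ Real.pi * ‖x - xs‖ ^ 2 := by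
  have h := measureReal_mono (μ := volume) (Set.sdiff_subset : exposedDisc x xs ⊆ _)
    Metric.isBounded_ball.measure_lt_top.ne
  rwa [volume_real_ball_plane, max_eq_left (norm_nonneg _)] at h

theorem volume_real_exposedDisc_zero (x : Plane) :
    volume.real (exposedDisc x 0) = Real.pi * ‖x‖ ^ 2 := by
  simp [exposedDisc, volume_real_ball_plane]

/-- A short step from `xs` towards `x` decreases the norm, so it enters both discs; their open
intersection has positive area. -/
theorem volume_real_exposedDisc_lt {x xs : Plane} (h : inner ℝ xs (x - xs) < 0) :
    volume.real (exposedDisc x xs) < Real.pi * ‖x - xs‖ ^ 2 := by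
  set v := x - xs with hv
  have hv0 : 0 < ‖v‖ := by
    rw [norm_pos_iff]
    intro h0
    simp [h0] at h
  -- The last bound says that `‖xs + t • v‖ < ‖xs‖`, after multiplying by `t`.
  obtain ⟨t, ht0, ht1, ht2⟩ : ∃ t : ℝ, 0 < t ∧ t ≤ 1 ∧ t * ‖v‖ ^ 2 < -2 * inner ℝ xs v := by
    have hc : Tendsto (fun t : ℝ => t * ‖v‖ ^ 2) (𝓝[>] 0) (𝓝 0) := by
      have : Continuous fun t : ℝ => t * ‖v‖ ^ 2 := by fun_prop
      simpa using (this.tendsto 0).mono_left (nhdsWithin_le_nhds (s := Set.Ioi 0))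
    obtain ⟨t, ⟨h1, h2⟩, h3⟩ := ((hc.eventually (gt_mem_nhds (show 0 < -2 * inner ℝ xs v by
      linarith))).and (nhdsWithin_le_nhds (Iio_mem_nhds one_pos))).and self_mem_nhdsWithin |>.exists
    exact ⟨t, h3, le_of_lt h2, h1⟩
  have hne : (Metric.ball x ‖v‖ ∩ Metric.ball 0 ‖xs‖).Nonempty := by
    refine ⟨xs + t • v, ?_, ?_⟩
    · have he : xs + t • v - x = (t - 1) • v := by rw [sub_smul, hv]; module
      rw [mem_ball_iff_norm, he, norm_smul, Real.norm_eq_abs, abs_of_nonpos (by linarith)]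
      nlinarith
    · rw [mem_ball_zero_iff]
      refine lt_of_pow_lt_pow_left₀ 2 (norm_nonneg _) ?_
      rw [norm_add_sq_real, norm_smul, inner_smul_right, Real.norm_eq_abs, mul_pow, sq_abs]
      nlinarith
  have hpos : 0 < volume.real (Metric.ball x ‖v‖ ∩ Metric.ball 0 ‖xs‖) :=
    ENNReal.toReal_pos ((Metric.isOpen_ball.inter Metric.isOpen_ball).measure_pos volume hne).ne'
      (Metric.isBounded_ball.subset Set.inter_subset_left).measure_lt_top.ne
  have hsum := measureReal_inter_add_sdiff (μ := volume) (s := Metric.ball x ‖v‖)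
    (Metric.isOpen_ball (x := (0 : Plane)) (ε := ‖xs‖)).measurableSet
    Metric.isBounded_ball.measure_lt_top.ne
  rw [volume_real_ball_plane x, max_eq_left (norm_nonneg _)] at hsum
  rw [exposedDisc]
  linarith

theorem measurable_volume_real_exposedDisc (xs : Plane) :
    Measurable fun x : Plane => volume.real (exposedDisc x xs) := by
  have hs : MeasurableSet {p : Plane × Plane | p.2 ∈ exposedDisc p.1 xs} := by
    simp only [exposedDisc, Set.mem_sdiff, mem_ball_iff_norm, sub_zero, not_lt]
    have h1 : MeasurableSet {p : Plane × Plane | ‖p.2 - p.1‖ < ‖p.1 - xs‖} :=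
      (isOpen_lt (by fun_prop) (by fun_prop)).measurableSet
    have h2 : MeasurableSet {p : Plane × Plane | ‖xs‖ ≤ ‖p.2‖} :=
      (isClosed_le (by fun_prop) (by fun_prop)).measurableSet
    exact h1.inter h2
  exact (measurable_measure_prodMk_left hs).ennreal_toReal

theorem exists_angle_inner_neg {a b : ℝ} (h : ¬(a = 0 ∧ b = 0)) :
    ∃ θ ∈ Set.Ioo 0 (2 * Real.pi), a * Real.cos θ + b * Real.sin θ < 0 := by
  have hpi := Real.pi_pos
  rcases lt_trichotomy b 0 with hb | rfl | hb
  · exact ⟨Real.pi / 2, ⟨by linarith, by linarith⟩, by simpa using hb⟩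
  · rcases lt_or_gt_of_ne (show a ≠ 0 by simpa using h) with ha | ha
    -- The natural angle `0` is an endpoint of the open interval; any interior angle with positive
    -- cosine serves.
    · refine ⟨Real.pi / 3, ⟨by linarith, by linarith⟩, ?_⟩
      simp [Real.cos_pi_div_three]
      linarith
    · exact ⟨Real.pi, ⟨by linarith, by linarith⟩, by simpa using ha⟩
  · refine ⟨Real.pi + Real.pi / 2, ⟨by linarith, by linarith⟩, ?_⟩
    simpa [Real.cos_add, Real.sin_add] using hb

/-! ### Averaging over the angle -/

section AngularAverage

variable {Ω : Type*} [MeasurableSpace Ω] {P : Measure Ω} [IsProbabilityMeasure P]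
  {Φ : Ω → Set Plane} {lam : ℝ}

namespace IsHPPP

theorem intervalIntegrable_pca (hΦ : IsHPPP P Φ lam) (hlam : 0 < lam) (xs : Plane) (r : ℝ) :
    IntervalIntegrable (fun θ : ℝ => pca P Φ (polarPoint r θ + xs) xs) volume 0
      (2 * Real.pi) := by
  simp_rw [hΦ.pca_eq hlam]
  refine (intervalIntegrable_const (c := (1 : ℝ))).mono_fun ?_ (ae_of_all _ fun θ => ?_)
  · have h1 := (measurable_volume_real_exposedDisc xs).comp
      ((continuous_polarPoint r).add continuous_const : Continuous fun θ =>
        polarPoint r θ + xs).measurable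
    exact (((h1.const_mul lam).neg).exp).aestronglyMeasurable
  · dsimp only
    rw [Real.norm_eq_abs, abs_of_pos (Real.exp_pos _), norm_one, Real.exp_le_one_iff,
      neg_nonpos]
    exact mul_nonneg hlam.le measureReal_nonneg

theorem exp_le_pca (hΦ : IsHPPP P Φ lam) (hlam : 0 < lam) (xs : Plane) (r θ : ℝ) :
    Real.exp (-(lam * Real.pi * r ^ 2)) ≤ pca P Φ (polarPoint r θ + xs) xs := by
  rw [hΦ.pca_eq hlam, Real.exp_le_exp, neg_le_neg_iff, mul_assoc]
  have h := volume_real_exposedDisc_le (polarPoint r θ + xs) xs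
  rw [add_sub_cancel_right, norm_polarPoint, sq_abs] at h
  exact mul_le_mul_of_nonneg_left h hlam.le

theorem exp_lt_pca (hΦ : IsHPPP P Φ lam) (hlam : 0 < lam) {xs : Plane} {r θ : ℝ} (hr : 0 < r)
    (hθ : xs 0 * Real.cos θ + xs 1 * Real.sin θ < 0) :
    Real.exp (-(lam * Real.pi * r ^ 2)) < pca P Φ (polarPoint r θ + xs) xs := by
  rw [hΦ.pca_eq hlam, Real.exp_lt_exp, neg_lt_neg_iff, mul_assoc]
  have h := volume_real_exposedDisc_lt (x := polarPoint r θ + xs) (xs := xs) (by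
    rw [add_sub_cancel_right, inner_polarPoint]
    exact mul_neg_of_pos_of_neg hr hθ)
  rw [add_sub_cancel_right, norm_polarPoint, sq_abs] at h
  exact mul_lt_mul_of_pos_left h hlam

theorem pca_zero (hΦ : IsHPPP P Φ lam) (hlam : 0 < lam) (r θ : ℝ) :
    pca P Φ (polarPoint r θ + 0) 0 = Real.exp (-(lam * Real.pi * r ^ 2)) := by
  rw [hΦ.pca_eq hlam, volume_real_exposedDisc_zero, add_zero, norm_polarPoint, sq_abs, mul_assoc]

theorem le_integral_pca (hΦ : IsHPPP P Φ lam) (hlam : 0 < lam) (xs : Plane) (r : ℝ) :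
    2 * Real.pi * Real.exp (-(lam * Real.pi * r ^ 2)) ≤
      ∫ θ in (0 : ℝ)..(2 * Real.pi), pca P Φ (polarPoint r θ + xs) xs := by
  have h := intervalIntegral.integral_mono_on Real.two_pi_pos.le intervalIntegrable_const
    (hΦ.intervalIntegrable_pca hlam xs r) fun θ _ => hΦ.exp_le_pca hlam xs r θ
  simpa using h

/-- Directions with negative inner product with `xs` form a nonempty open set of angles, hence one
of positive measure, where the pointwise bound is strict. -/
theorem lt_integral_pca (hΦ : IsHPPP P Φ lam) (hlam : 0 < lam) {xs : Plane} (hxs : xs ≠ 0) {r : ℝ}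
    (hr : 0 < r) :
    2 * Real.pi * Real.exp (-(lam * Real.pi * r ^ 2)) <
      ∫ θ in (0 : ℝ)..(2 * Real.pi), pca P Φ (polarPoint r θ + xs) xs := by
  have hab : ¬(xs 0 = 0 ∧ xs 1 = 0) := by
    rintro ⟨h0, h1⟩
    apply hxs
    ext i
    fin_cases i
    · exact h0
    · exact h1
  have hopen : IsOpen (Set.Ioo 0 (2 * Real.pi) ∩
      {θ : ℝ | xs 0 * Real.cos θ + xs 1 * Real.sin θ < 0}) :=
    isOpen_Ioo.inter (isOpen_lt (by fun_prop) continuous_const)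
  have hne : (volume.restrict (Set.Ioc 0 (2 * Real.pi))) {θ : ℝ |
      Real.exp (-(lam * Real.pi * r ^ 2)) < pca P Φ (polarPoint r θ + xs) xs} ≠ 0 := by
    refine ((hopen.measure_pos volume (exists_angle_inner_neg hab)).trans_le ?_).ne'
    rw [← Measure.restrict_eq_self volume
      (Set.inter_subset_left.trans Set.Ioo_subset_Ioc_self : _ ⊆ Set.Ioc 0 (2 * Real.pi))]
    exact measure_mono fun θ hθ => hΦ.exp_lt_pca hlam hr hθ.2
  have h := intervalIntegral.integral_lt_integral_of_ae_le_of_measure_setOfPred_lt_ne_zero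
    Real.two_pi_pos.le intervalIntegrable_const (hΦ.intervalIntegrable_pca hlam xs r)
    (ae_of_all _ fun θ => hΦ.exp_le_pca hlam xs r θ) hne
  simpa using h

theorem integral_pca_zero (hΦ : IsHPPP P Φ lam) (hlam : 0 < lam) (r : ℝ) :
    ∫ θ in (0 : ℝ)..(2 * Real.pi), pca P Φ (polarPoint r θ + 0) 0 =
      2 * Real.pi * Real.exp (-(lam * Real.pi * r ^ 2)) := by
  simp_rw [hΦ.pca_zero hlam]
  simp

theorem integral_pca_radius_zero (hΦ : IsHPPP P Φ lam) (hlam : 0 < lam) (xs : Plane) :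
    ∫ θ in (0 : ℝ)..(2 * Real.pi), pca P Φ (polarPoint 0 θ + xs) xs = 2 * Real.pi := by
  have h : ∀ θ, polarPoint 0 θ = 0 := fun θ => by
    rw [← norm_eq_zero, norm_polarPoint, abs_zero]
  simp_rw [h, hΦ.pca_eq hlam]
  -- At `x = xs` the disc has radius `0` and is empty, so the integrand is `1`.
  simp [exposedDisc]

end IsHPPP

end AngularAverage

/-- The first two conjuncts say that the conditional probabilities and the angular integral which
define the equivalent density are well defined. -/
theorem lemma3 {Ω : Type*} [MeasurableSpace Ω] (P : Measure Ω) [IsProbabilityMeasure P]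
    (Φa : Ω → Set Plane) (lamA lamU : ℝ) (hA : 0 < lamA) (hU : 0 < lamU)
    (hΦa : IsHPPP P Φa lamA) (xs : Plane) :
    (∀ x : Plane, Tendsto (pcaApprox P Φa x xs) (𝓝[>] (0 : ℝ)) (𝓝 (pca P Φa x xs))) ∧
    (∀ r : ℝ, 0 ≤ r → IntervalIntegrable (fun θ : ℝ => pca P Φa (polarPoint r θ + xs) xs)
      volume 0 (2 * Real.pi)) ∧
    (∀ r : ℝ, 0 ≤ r →
      ueDensity P Φa lamU xs xs r ≤ lamU * (1 - Real.exp (-(lamA * Real.pi * r ^ 2)))) ∧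
    (∀ r : ℝ, 0 < r →
      (ueDensity P Φa lamU xs xs r = lamU * (1 - Real.exp (-(lamA * Real.pi * r ^ 2))) ↔
        xs = 0)) ∧
    ueDensity P Φa lamU xs xs 0 = 0 := by
  have hpi := Real.two_pi_pos
  have hdens : ∀ r : ℝ, ueDensity P Φa lamU xs xs r = lamU * (1 - (∫ θ in (0 : ℝ)..(2 * Real.pi),
      pca P Φa (polarPoint r θ + xs) xs) / (2 * Real.pi)) := fun r => by
    rw [ueDensity, one_div_mul_eq_div]
  refine ⟨fun x => ?_, fun r _ => hΦa.intervalIntegrable_pca hA xs r, fun r _ => ?_,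
    fun r hr => ⟨fun heq => ?_, ?_⟩, ?_⟩
  · rw [hΦa.pca_eq hA]
    exact hΦa.tendsto_pcaApprox hA x xs
  · rw [hdens]
    refine mul_le_mul_of_nonneg_left (sub_le_sub_left ?_ _) hU.le
    rw [le_div_iff₀' hpi]
    exact hΦa.le_integral_pca hA xs r
  · by_contra hxs
    have hlt := hΦa.lt_integral_pca hA hxs hr
    rw [← lt_div_iff₀' hpi] at hlt
    rw [hdens] at heq
    linarith [mul_left_cancel₀ hU.ne' heq]
  · rintro rfl
    rw [hdens, hΦa.integral_pca_zero hA, mul_div_cancel_left₀ _ hpi.ne']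
  · rw [hdens, hΦa.integral_pca_radius_zero hA, div_self hpi.ne', sub_self, mul_zero]
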